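/- Let $0<d<n$ be integers and let $\mathbf G(d,n)$ be the space of $d$-dimensional planes (affine subspaces) in $\mathbf R^n$. For a Schwartz function $f:\mathbf R^n\to\mathbf C$ let $$\hat f(\xi)=\int_\xi f\,dm,\qquad \xi\in\mathbf G(d,n),$$ $dm$ being the Euclidean measure on $\xi$, denote its $d$-plane transform. For a function $\varphi$ on $\mathbf G(d,n)$, $x\in\mathbf R^n$ and $p\ge 0$ let $\check\varphi_p(x)$ be the average of $\varphi$ over the set of $d$-planes at distance $p$ from $x$, i.e. $$\check\varphi_p(x)=\int_{\mathbf O(n)}\varphi\bigl(x+k(\xi-x)\bigr)\,dk ,$$ where $\xi$ is any $d$-plane at distance $p$ from $x$ and $dk$ is the Haar measure on $\mathbf O(n)$ of total mass $1$. For $p<0$ put $\check\varphi_p=\check\varphi_{-p}$, so that $p\mapsto\check\varphi_p(x)$ is even on $\mathbf R$. Theorem 4.1. The $d$-plane transform is inverted as follows, for all $n>d$, all Schwartz functions $f$ on $\mathbf R^n$ and all $x\in\mathbf R^n$. The integrals defining $\hat f(\xi)$ and $(\hat f)^{\vee}_p(x)$ converge absolutely for all $\xi$, $p$, $x$, and: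 (i) If $d$ is even, there is a constant $C_1$ depending only on $d$ such that $$f(x)=C_1\left[\left(\frac{d}{dr}\right)^{d}(\hat f)^{\vee}_r(x)\right]_{r=0},$$ where $r\mapsto(\hat f)^{\vee}_r(x)$ is $d$ times continuously differentiable on $\mathbf R$. (ii) If $d$ is odd, there is a constant $C_2$ depending only on $d$ such that $$f(x)=C_2\left[\left(\frac{d}{d(r^2)}\right)^{(d-1)/2}\int_r^\infty (p^2-r^2)^{-1/2}\,\frac{d}{dp}(\hat f)^{\vee}_p(x)\,dp\right]_{r=0},$$ where $p\mapsto(\hat f)^{\vee}_p(x)$ is differentiable on $\mathbf R$, the integral converges absolutely for every $r\ge 0$, and, as a function of $s=r^2\in[0,\infty)$, it is $(d-1)/2$ times continuously differentiable on $[0,\infty)$ (one-sided derivatives at $s=0$; for $d=1$ no derivative is taken). (iii) If $d=1$, then $$f(x)=-\frac1\pi\int_0^\infty\frac1p\,\frac{d}{dp}(\hat f)^{\vee}_p(x)\,dp ,$$ where $p\mapsto(\hat f)^{\vee}_p(x)$ is differentiable on $\mathbf R$ and the integral converges absolutely. -/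

import Mathlib

open MeasureTheory Set
open scoped SchwartzMap

noncomputable section

namespace DPlaneTransform

/-- Euclidean space `ℝⁿ`. -/
abbrev E (n : ℕ) := EuclideanSpace ℝ (Fin n)

/-- The space `G(d, n)` of `d`-dimensional planes (affine subspaces) in `ℝⁿ`. -/
abbrev DPlane (d n : ℕ) : Type :=
  {ξ : AffineSubspace ℝ (E n) // (ξ : Set (E n)).Nonempty ∧ Module.finrank ℝ ξ.direction = d}

/-- The Euclidean measure `dm` on a `d`-plane `ξ`, as a measure on `ℝⁿ` carried by `ξ`:
the `d`-dimensional Hausdorff measure, normalized to agree with Lebesgue measure. -/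
def planeMeasure {d n : ℕ} (ξ : DPlane d n) : Measure (E n) :=
  (Measure.euclideanHausdorffMeasure d).restrict (ξ.1 : Set (E n))

/-- The `d`-plane transform `f̂(ξ) = ∫_ξ f dm`. -/
def dPlaneTransform (d : ℕ) {n : ℕ} (f : E n → ℂ) (ξ : DPlane d n) : ℂ :=
  ∫ y, f y ∂(planeMeasure ξ)

/-- The orthogonal group `O(n)`, as the group of orthogonal operators on `ℝⁿ`. -/
abbrev O (n : ℕ) := unitary (E n →L[ℝ] E n)

instance (n : ℕ) : ContinuousStar (E n →L[ℝ] E n) :=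
  ⟨(ContinuousLinearMap.adjoint : (E n →L[ℝ] E n) ≃ₗᵢ⋆[ℝ] (E n →L[ℝ] E n)).continuous⟩

lemma isCompact_orthogonal (n : ℕ) :
    IsCompact ((unitary (E n →L[ℝ] E n) : Submonoid (E n →L[ℝ] E n)) : Set (E n →L[ℝ] E n)) := by
  have : ProperSpace (E n →L[ℝ] E n) := FiniteDimensional.proper ℝ _
  refine Metric.isCompact_of_isClosed_isBounded isClosed_unitary ?_
  refine (Metric.isBounded_closedBall (x := (0 : E n →L[ℝ] E n)) (r := 1)).subset ?_
  intro u hu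
  rw [mem_closedBall_zero_iff]
  refine ContinuousLinearMap.opNorm_le_bound _ zero_le_one fun v => ?_
  rw [one_mul]
  exact ((Unitary.linearIsometryEquiv (⟨u, hu⟩ : O n)).norm_map v).le

instance (n : ℕ) : CompactSpace (O n) :=
  isCompact_iff_compactSpace.mp (isCompact_orthogonal n)

/-- The normalized Haar measure `dk` on `O(n)` (total mass one). -/
def haarO (n : ℕ) : Measure (O n) := Measure.haarMeasure ⊤

/-- The rigid motion `y ↦ x + k (y - x)`: the element `k ∈ O(n)` acting about the point `x`. -/
def motion {n : ℕ} (x : E n) (k : O n) : E n ≃ᵃⁱ[ℝ] E n :=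
  AffineIsometryEquiv.mk' (fun y => Unitary.linearIsometryEquiv k (y - x) + x)
    (Unitary.linearIsometryEquiv k) x (by intro y; simp)

/-- The image of the `d`-plane `ξ` under `k ∈ O(n)` acting about the point `x`. -/
def rotate {d n : ℕ} (x : E n) (k : O n) (ξ : DPlane d n) : DPlane d n :=
  ⟨ξ.1.map (motion x k).toAffineEquiv.toAffineMap, by
    refine ⟨?_, ?_⟩
    · rw [AffineSubspace.coe_map]
      exact ξ.2.1.image _
    · rw [AffineSubspace.map_direction]
      exact ((motion x k).toAffineEquiv.linear.finrank_map_eq ξ.1.direction).trans ξ.2.2⟩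

/-- For `d < n`, the `d`-plane through `x + p • e_d` parallel to the span of the first `d`
coordinate vectors `e_0, …, e_{d-1}`. Its distance from `x` is `|p|`. -/
def basePlane {d n : ℕ} (h : d < n) (x : E n) (p : ℝ) : DPlane d n :=
  ⟨AffineSubspace.mk' (x + p • EuclideanSpace.single (⟨d, h⟩ : Fin n) (1 : ℝ))
      (Submodule.span ℝ (range fun i : Fin d =>
        (EuclideanSpace.single (Fin.castLE h.le i) (1 : ℝ) : E n))), by
    refine ⟨AffineSubspace.mk'_nonempty _ _, ?_⟩
    rw [AffineSubspace.direction_mk', finrank_span_eq_card, Fintype.card_fin]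
    have := (EuclideanSpace.orthonormal_single (𝕜 := ℝ) (ι := Fin n)).linearIndependent
    exact this.comp (fun i : Fin d => Fin.castLE h.le i) (Fin.castLE_injective h.le)⟩

/-- `φˇ_p(x)`: the average of `φ` over the set of `d`-planes at distance `|p|` from `x`.
The group `O(n)` acting about `x` is transitive on this set, and the average is the one given by
the normalized Haar measure of `O(n)`. Allowing `p < 0` extends the average, which a priori is
defined for `p ≥ 0`, to an even function of `p`. -/
def dualAverage {d n : ℕ} (h : d < n) (φ : DPlane d n → ℂ) (p : ℝ) (x : E n) : ℂ :=
  ∫ k, φ (rotate x k (basePlane h x p)) ∂(haarO n)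

/-- `p ↦ (f̂)ˇ_p(x)`. -/
def hatCheck {d n : ℕ} (h : d < n) (f : E n → ℂ) (x : E n) (p : ℝ) : ℂ :=
  dualAverage h (dPlaneTransform d f) p x

/-- The integrand `(p² - r²)^{-1/2} (d/dp) (f̂)ˇ_p(x)`, as a function of `p`. -/
def abelIntegrand {d n : ℕ} (h : d < n) (f : E n → ℂ) (x : E n) (r p : ℝ) : ℂ :=
  ((p ^ 2 - r ^ 2) ^ (-(1 / 2) : ℝ) : ℝ) • deriv (hatCheck h f x) p

/-- `∫_r^∞ (p² - r²)^{-1/2} (d/dp) (f̂)ˇ_p(x) dp`. -/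
def abelIntegral {d n : ℕ} (h : d < n) (f : E n → ℂ) (x : E n) (r : ℝ) : ℂ :=
  ∫ p in Ioi r, abelIntegrand h f x r p

/-- `[(d/d(r²))^m G(r)]_{r=0}` for a function `G` of `r ≥ 0`: the `m`-th (one-sided) derivative at
`s = 0` of `G` written as a function of `s = r² ≥ 0`. -/
def derivSqAtZero (m : ℕ) (G : ℝ → ℂ) : ℂ :=
  iteratedDerivWithin m (fun s : ℝ => G (Real.sqrt s)) (Ici 0) 0

end DPlaneTransform

end

/-!
The spherical mean of `f` about `x` depends only on the radius; write it as a function `φ₂` of the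
squared radius. A `d`-plane at distance `p` from `x` meets, at orthogonal coordinates `y ∈ ℝᵈ`, the
sphere of squared radius `p² + |y|²`. Interchanging the average over `O(n)` with the integral over
the plane therefore gives
`(f̂)ˇ_p(x) = ∫_{ℝᵈ} φ₂(p² + |y|²) dy`
(`hatCheck_eq_integral_sphericalMean`). With the operator `T φ(σ) = ∫_ℝ φ(σ + u²) du`, called
`lineLift` below, the right-hand side is `T^d φ₂ (p²)` (`RapidDecay.integral_comp_add_sum_sq`).

Polar coordinates in the plane give `T² φ(σ) = π ∫_σ^∞ φ`, so that `(T^{k+2} φ)' = -π T^k φ`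
(`RapidDecay.hasDerivAt_lineLift_lineLift`): each derivative in `σ = p²` removes two lifts.

* If `d = 2m`, the derivatives of order `2m` in `p` at `0` reduce to `φ₂(0) = f(x)` up to the
  constant `evenConst m` (`RapidDecay.iteratedDeriv_iterate_sq`).
* If `d` is odd, the Abel integral of the derivative is, after the substitution `p² = r² + u²`, one
  more application of `T`; hence it is `-π T^{d-1} φ₂ (r²)` (`abelIntegral_of_profile`). Now `d - 1`
  is even, and `(d-1)/2` derivatives in `r²` leave a multiple of `φ₂`. For `d = 1` none is needed,
  and the constant is `-1/π`.

The first derivatives of `φ₂` and `T φ₂` are needed as well, so everything is expressed through a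
function `φ` with `φ₂ = T² φ` on `[0, ∞)`, that is `φ = -φ₂'/π` (`radialProfile`).
It is continuous up to `0` because the spherical mean is an even smooth function
of the radius. The profile is extended to all of `ℝ`, which makes the one-sided derivatives at
`r² = 0` restrictions of two-sided ones.
-/

namespace DPlaneTransform

open Filter Topology ContDiff

/-! ### Rapidly decaying functions and integration along a line -/

/-- A continuous function on `ℝ` that decays faster than every power at `+∞`, uniformly on each
half-line `[a, ∞)`. Nothing is asked at `-∞`: only the values on `[0, ∞)` matter for the transform,
and the negative half-line is kept so that derivatives at `0` are two-sided. -/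
structure RapidDecay (φ : ℝ → ℂ) : Prop where
  continuous : Continuous φ
  bound : ∀ (a : ℝ) (N : ℕ), ∃ C : ℝ, ∀ σ, a ≤ σ → (1 + (σ - a)) ^ N * ‖φ σ‖ ≤ C

lemma RapidDecay.of_bound {φ : ℝ → ℂ} (hφ : Continuous φ)
    (h : ∀ N : ℕ, ∃ C : ℝ, ∀ σ, 1 ≤ σ → σ ^ N * ‖φ σ‖ ≤ C) : RapidDecay φ := by
  refine ⟨hφ, fun a N => ?_⟩
  obtain ⟨C, hC⟩ := h N
  obtain ⟨B, hB⟩ := (isCompact_Icc (a := a) (b := 1)).exists_bound_of_continuousOn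
    (f := fun σ => ((1 + (σ - a)) ^ N : ℝ) * ‖φ σ‖) (by fun_prop)
  refine ⟨max B ((2 + |a|) ^ N * C), fun σ hσ => ?_⟩
  rcases le_total σ 1 with h1 | h1
  · exact (le_abs_self _).trans ((hB σ ⟨hσ, h1⟩).trans (le_max_left _ _))
  · refine le_trans ?_ (le_max_right _ _)
    have h2 : 1 + (σ - a) ≤ (2 + |a|) * σ := by
      nlinarith [neg_abs_le a, abs_nonneg a]
    calc (1 + (σ - a)) ^ N * ‖φ σ‖ ≤ ((2 + |a|) * σ) ^ N * ‖φ σ‖ := by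
          gcongr
      _ = (2 + |a|) ^ N * (σ ^ N * ‖φ σ‖) := by rw [mul_pow, mul_assoc]
      _ ≤ _ := by gcongr; exact hC σ h1

/-- Splitting the decay between a factor in the base point and an integrable factor in the
increment `t`, which serves as the dominating function for `lineLift`. -/
lemma RapidDecay.norm_le {φ : ℝ → ℂ} (hφ : RapidDecay φ) (a : ℝ) (N : ℕ) :
    ∃ C : ℝ, 0 ≤ C ∧ ∀ σ t, a ≤ σ → 0 ≤ t →
      ‖φ (σ + t)‖ ≤ C * ((1 + (σ - a)) ^ N)⁻¹ * (1 + t)⁻¹ := by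
  obtain ⟨C, hC⟩ := hφ.bound a (N + 1)
  have hC0 : 0 ≤ C := le_trans (by simp) (hC a le_rfl)
  refine ⟨C, hC0, fun σ t hσ ht => ?_⟩
  have h := hC (σ + t) (by linarith)
  have h1 : 0 < 1 + (σ - a) := by linarith
  rw [mul_assoc, ← mul_inv, ← div_eq_mul_inv, le_div_iff₀ (by positivity), mul_comm]
  refine le_trans ?_ h
  rw [pow_succ]
  have h2 : 1 + (σ - a) ≤ 1 + (σ + t - a) := by linarith
  have h3 : 1 + t ≤ 1 + (σ + t - a) := by linarith
  have h4 : 0 ≤ 1 + (σ + t - a) := by linarith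
  gcongr

/-- The function `σ ↦ ∫ φ(σ + u²) du` over the line. If `φ(|v|²)` is a radial function, this
integrates out one variable orthogonal to `v`. -/
noncomputable def lineLift (φ : ℝ → ℂ) (σ : ℝ) : ℂ := ∫ u : ℝ, φ (σ + u ^ 2)

lemma RapidDecay.integrable_comp_add_sq {φ : ℝ → ℂ} (hφ : RapidDecay φ) (σ : ℝ) :
    Integrable fun u : ℝ => φ (σ + u ^ 2) := by
  obtain ⟨C, -, hC⟩ := hφ.norm_le σ 0
  refine (integrable_inv_one_add_sq.const_mul C).mono'
    (hφ.continuous.comp (by fun_prop)).aestronglyMeasurable (Eventually.of_forall fun u => ?_)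
  simpa using hC σ (u ^ 2) le_rfl (sq_nonneg u)

lemma RapidDecay.lift {φ : ℝ → ℂ} (hφ : RapidDecay φ) : RapidDecay (lineLift φ) := by
  refine ⟨continuous_iff_continuousAt.2 fun σ₀ => ?_, fun a N => ?_⟩
  · obtain ⟨C, -, hC⟩ := hφ.norm_le (σ₀ - 1) 0
    refine continuousAt_of_dominated (bound := fun u => C * (1 + u ^ 2)⁻¹)
      (Eventually.of_forall fun σ => (hφ.integrable_comp_add_sq σ).aestronglyMeasurable) ?_
      (integrable_inv_one_add_sq.const_mul C) (Eventually.of_forall fun u => ?_)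
    · filter_upwards [lt_mem_nhds (sub_one_lt σ₀)] with σ hσ
      refine Eventually.of_forall fun u => ?_
      simpa using hC σ (u ^ 2) hσ.le (sq_nonneg u)
    · exact (hφ.continuous.comp (by fun_prop : Continuous fun σ : ℝ => σ + u ^ 2)).continuousAt
  · obtain ⟨C, hC0, hC⟩ := hφ.norm_le a N
    refine ⟨C * Real.pi, fun σ hσ => ?_⟩
    have h1 : 0 < 1 + (σ - a) := by linarith
    have h2 : ‖lineLift φ σ‖
        ≤ ∫ u : ℝ, C * ((1 + (σ - a)) ^ N)⁻¹ * (1 + u ^ 2)⁻¹ :=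
      norm_integral_le_of_norm_le (integrable_inv_one_add_sq.const_mul _)
        (Eventually.of_forall fun u => hC σ (u ^ 2) hσ (sq_nonneg u))
    rw [integral_const_mul, integral_univ_inv_one_add_sq] at h2
    calc _ ≤ (1 + (σ - a)) ^ N * (C * ((1 + (σ - a)) ^ N)⁻¹ * Real.pi) := by gcongr
      _ = C * Real.pi := by field_simp

lemma RapidDecay.iterate {φ : ℝ → ℂ} (hφ : RapidDecay φ) (k : ℕ) :
    RapidDecay (lineLift^[k] φ) := by
  induction k generalizing φ with
  | zero => exact hφ
  | succ k ih => exact ih hφ.lift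

lemma RapidDecay.integrable_comp_add_sum_sq {φ : ℝ → ℂ} (hφ : RapidDecay φ) (k : ℕ) (σ : ℝ) :
    Integrable fun y : Fin k → ℝ => φ (σ + ∑ i, y i ^ 2) := by
  obtain ⟨C, hC⟩ := hφ.bound σ k
  have hC0 : 0 ≤ C := le_trans (by simp) (hC σ le_rfl)
  refine ((Integrable.fintype_prod (f := fun (_ : Fin k) (u : ℝ) => (1 + u ^ 2)⁻¹)
    (fun _ => integrable_inv_one_add_sq)).const_mul C).mono'
    (hφ.continuous.comp (by fun_prop)).aestronglyMeasurable (Eventually.of_forall fun y => ?_)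
  have h1 := hC (σ + ∑ i, y i ^ 2) (by
    have : 0 ≤ ∑ i, y i ^ 2 := Finset.sum_nonneg fun i _ => sq_nonneg _
    linarith)
  have h2 : ∏ i, (1 + y i ^ 2) ≤ (1 + ∑ i, y i ^ 2) ^ k := by
    calc ∏ i, (1 + y i ^ 2) ≤ ∏ _i : Fin k, (1 + ∑ i, y i ^ 2) :=
          Finset.prod_le_prod (fun i _ => by positivity) fun i _ => by
            have := Finset.single_le_sum (f := fun i => y i ^ 2) (fun i _ => sq_nonneg _)
              (Finset.mem_univ i)
            linarith
      _ = _ := by simp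
  rw [add_sub_cancel_left] at h1
  have h3 : 0 < ∏ i, (1 + y i ^ 2) := Finset.prod_pos fun i _ => by positivity
  rw [Finset.prod_inv_distrib, ← div_eq_mul_inv, le_div_iff₀ h3, mul_comm]
  exact le_trans (by gcongr) h1

/-- Integrating out `k` orthogonal variables is the same as applying `lineLift` `k` times. -/
lemma RapidDecay.integral_comp_add_sum_sq {φ : ℝ → ℂ} (hφ : RapidDecay φ) (k : ℕ) (σ : ℝ) :
    ∫ y : Fin k → ℝ, φ (σ + ∑ i, y i ^ 2) = lineLift^[k] φ σ := by
  induction k generalizing φ with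
  | zero => simp [integral_unique, Measure.real, volume_pi]
  | succ k ih =>
    have hp := (volume_preserving_piFinSuccAbove (fun _ : Fin (k + 1) => ℝ) 0).symm
    have hi := (hp.integrable_comp_emb (MeasurableEquiv.measurableEmbedding _)).2
      (hφ.integrable_comp_add_sum_sq (k + 1) σ)
    rw [Function.iterate_succ_apply, ← ih hφ.lift,
      ← hp.integral_comp (MeasurableEquiv.measurableEmbedding _)]
    rw [Measure.volume_eq_prod] at hi ⊢
    refine (integral_prod_symm _ hi).trans (integral_congr_ae (Eventually.of_forall fun y => ?_))
    refine integral_congr_ae (Eventually.of_forall fun u => ?_)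
    simp [Fin.sum_univ_succ, MeasurableEquiv.piFinSuccAbove_symm_apply]
    ring_nf

/-- Two applications of `lineLift` amount, in polar coordinates of the plane, to `π` times the
antiderivative vanishing at `+∞`. -/
lemma RapidDecay.lineLift_lineLift {φ : ℝ → ℂ} (hφ : RapidDecay φ) (σ : ℝ) :
    lineLift (lineLift φ) σ = Real.pi * ∫ t in Ioi σ, φ t := by
  have hint : Integrable (fun z : ℝ × ℝ => φ (σ + z.1 ^ 2 + z.2 ^ 2)) := by
    obtain ⟨C, -, hC⟩ := hφ.norm_le σ 1
    refine ((integrable_inv_one_add_sq.mul_prod integrable_inv_one_add_sq).const_mul C).mono'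
      (hφ.continuous.comp (by fun_prop)).aestronglyMeasurable (Eventually.of_forall fun z => ?_)
    have := hC (σ + z.1 ^ 2) (z.2 ^ 2) (by nlinarith [sq_nonneg z.1]) (sq_nonneg _)
    simpa [mul_assoc] using this
  have h1 : lineLift (lineLift φ) σ
      = ∫ z : ℝ × ℝ, φ (σ + z.1 ^ 2 + z.2 ^ 2) := by
    rw [Measure.volume_eq_prod] at hint ⊢
    exact (integral_prod _ hint).symm
  have h2 : ∀ z : ℝ × ℝ, z.1 • φ (σ + (polarCoord.symm z).1 ^ 2 + (polarCoord.symm z).2 ^ 2)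
      = ((z.1 : ℂ) * φ (σ + z.1 ^ 2)) * 1 := by
    intro z
    have : σ + (z.1 * Real.cos z.2) ^ 2 + (z.1 * Real.sin z.2) ^ 2 = σ + z.1 ^ 2 := by
      linear_combination z.1 ^ 2 * Real.sin_sq_add_cos_sq z.2
    simp [this]
  have himg : (fun r : ℝ => σ + r ^ 2) '' Ioi 0 = Ioi σ := by
    ext t
    simp only [mem_image, mem_Ioi]
    constructor
    · rintro ⟨r, hr, rfl⟩
      have := pow_pos hr 2
      linarith
    · intro ht
      exact ⟨Real.sqrt (t - σ), Real.sqrt_pos.2 (by linarith),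
        by rw [Real.sq_sqrt (by linarith)]; ring⟩
  have h3 : ∫ t in Ioi σ, φ t = 2 * ∫ r in Ioi (0 : ℝ), (r : ℂ) * φ (σ + r ^ 2) := by
    rw [← himg, integral_image_eq_integral_abs_deriv_smul (f' := fun r => 2 * r) measurableSet_Ioi
      (fun r _ => by
        simpa using ((hasDerivAt_pow 2 r).const_add σ).hasDerivWithinAt)
      (fun r hr s hs h => by
        have : r ^ 2 = s ^ 2 := by simpa using h
        exact (pow_left_inj₀ (le_of_lt hr) (le_of_lt hs) two_ne_zero).1 this),
      ← integral_const_mul]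
    refine setIntegral_congr_fun measurableSet_Ioi fun r hr => ?_
    have : |2 * r| = 2 * r := abs_of_pos (mul_pos two_pos hr)
    simp only [this, Complex.real_smul]
    push_cast; ring
  rw [h1, ← integral_comp_polarCoord_symm]
  simp_rw [h2]
  rw [polarCoord_target, Measure.volume_eq_prod, setIntegral_prod_mul
    (fun r : ℝ => (r : ℂ) * φ (σ + r ^ 2)) (fun _ => (1 : ℂ)), h3]
  have : Real.pi + Real.pi = 2 * Real.pi := by ring
  simp only [integral_const, mul_one, measureReal_restrict_apply_univ,
    Real.volume_real_Ioo, sub_neg_eq_add, this, max_eq_left Real.two_pi_pos.le, Complex.real_smul]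
  push_cast
  ring
lemma RapidDecay.integrableOn_Ioi {φ : ℝ → ℂ} (hφ : RapidDecay φ) (σ : ℝ) :
    IntegrableOn φ (Ioi σ) := by
  obtain ⟨C, hC⟩ := hφ.bound σ 2
  refine (((integrable_inv_one_add_sq.comp_sub_right σ).const_mul C).integrableOn).mono'
    hφ.continuous.aestronglyMeasurable (ae_restrict_of_forall_mem measurableSet_Ioi fun t ht => ?_)
  rw [← div_eq_mul_inv, le_div_iff₀ (by positivity), mul_comm]
  refine le_trans ?_ (hC t (le_of_lt ht))
  have : 0 < t - σ := sub_pos.2 ht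
  gcongr
  nlinarith

lemma RapidDecay.hasDerivAt_lineLift_lineLift {φ : ℝ → ℂ} (hφ : RapidDecay φ) (σ : ℝ) :
    HasDerivAt (lineLift (lineLift φ)) (-Real.pi * φ σ) σ := by
  have h : lineLift (lineLift φ)
      = fun s => Real.pi * ((∫ t in Ioi σ, φ t) - ∫ t in σ..s, φ t) := by
    ext s
    rw [hφ.lineLift_lineLift, ← intervalIntegral.integral_interval_add_Ioi
      (hφ.integrableOn_Ioi σ) (hφ.integrableOn_Ioi s)]
    ring
  rw [h]
  rw [neg_mul, ← mul_neg]
  exact (((intervalIntegral.integral_hasDerivAt_right (hφ.continuous.intervalIntegrable σ σ)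
    (hφ.continuous.stronglyMeasurableAtFilter _ _) hφ.continuous.continuousAt).const_sub
      (∫ t in Ioi σ, φ t)).const_mul (Real.pi : ℂ))

/-! ### Derivatives of iterated lifts -/

lemma RapidDecay.hasDerivAt_iterate {φ : ℝ → ℂ} (hφ : RapidDecay φ) (k : ℕ) (σ : ℝ) :
    HasDerivAt (lineLift^[k + 2] φ)
      (-Real.pi * lineLift^[k] φ σ) σ := by
  rw [Function.iterate_succ', Function.iterate_succ']
  exact (hφ.iterate k).hasDerivAt_lineLift_lineLift σ

lemma RapidDecay.hasDerivAt_iterate_sq {φ : ℝ → ℂ} (hφ : RapidDecay φ) (k : ℕ) (p : ℝ) :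
    HasDerivAt (fun q : ℝ => lineLift^[k + 2] φ (q ^ 2))
      (-(2 * Real.pi) * (p * lineLift^[k] φ (p ^ 2))) p := by
  have h := (hφ.hasDerivAt_iterate k (p ^ 2)).scomp p (hasDerivAt_pow 2 p)
  convert! h using 1
  simp
  ring

lemma RapidDecay.deriv_iterate {φ : ℝ → ℂ} (hφ : RapidDecay φ) (k : ℕ) :
    deriv (lineLift^[k + 2] φ) = fun σ => (-Real.pi : ℂ) * lineLift^[k] φ σ :=
  funext fun σ => (hφ.hasDerivAt_iterate k σ).deriv

lemma RapidDecay.deriv_iterate_sq {φ : ℝ → ℂ} (hφ : RapidDecay φ) (k : ℕ) :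
    deriv (fun p : ℝ => lineLift^[k + 2] φ (p ^ 2))
      = fun p : ℝ => (-(2 * Real.pi) : ℂ) * (p * lineLift^[k] φ (p ^ 2)) :=
  funext fun p => (hφ.hasDerivAt_iterate_sq k p).deriv

lemma iteratedDeriv_succ_ofReal_mul {G : ℝ → ℂ} (hG : ContDiff ℝ ∞ G) (k : ℕ) :
    iteratedDeriv (k + 1) (fun p : ℝ => (p : ℂ) * G p)
      = fun p : ℝ => (p : ℂ) * iteratedDeriv (k + 1) G p + (k + 1) * iteratedDeriv k G p := by
  have hd : ∀ (j : ℕ) (p : ℝ), HasDerivAt (iteratedDeriv j G) (iteratedDeriv (j + 1) G p) p := by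
    intro j p
    rw [iteratedDeriv_succ]
    exact (hG.differentiable_iteratedDeriv j (by exact_mod_cast WithTop.coe_lt_top j)
      p).hasDerivAt
  induction k with
  | zero =>
    ext p
    have := (Complex.ofRealCLM.hasDerivAt (x := p)).mul (hd 0 p)
    rw [iteratedDeriv_one]
    refine this.deriv.trans ?_
    simp
    ring
  | succ k ih =>
    ext p
    rw [iteratedDeriv_succ, ih]
    have := ((Complex.ofRealCLM.hasDerivAt (x := p)).mul (hd (k + 1) p)).add
      ((hd k p).const_mul (k + 1 : ℂ))
    refine this.deriv.trans ?_
    simp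
    ring

/-- The reciprocal of the inversion constant in even dimension `2m`: each of the `m` steps
`2i + 2 → 2i` contributes the factor `-2π` of the chain rule and the factor `2i + 1` of the
Leibniz rule. -/
noncomputable def evenConst (m : ℕ) : ℝ := ∏ i ∈ Finset.range m, (-(2 * Real.pi) * (2 * i + 1))

lemma evenConst_ne_zero (m : ℕ) : evenConst m ≠ 0 :=
  Finset.prod_ne_zero_iff.2 fun i _ =>
    mul_ne_zero (neg_ne_zero.2 Real.two_pi_pos.ne') (by positivity)

/-- The smoothness of `p ↦ φ₂(p²)`, `φ₂` being the second lift, is a hypothesis because `φ₂` itself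
need not be smooth at `0`. -/
lemma RapidDecay.contDiff_iterate_sq {φ : ℝ → ℂ} (hφ : RapidDecay φ)
    (h2 : ContDiff ℝ ∞ fun p : ℝ => lineLift^[2] φ (p ^ 2)) (m : ℕ) :
    ContDiff ℝ ∞ fun p : ℝ => lineLift^[2 * m + 2] φ (p ^ 2) := by
  induction m with
  | zero => simpa using h2
  | succ m ih =>
    rw [contDiff_infty_iff_deriv, show 2 * (m + 1) + 2 = 2 * m + 2 + 2 by ring]
    refine ⟨fun p => (hφ.hasDerivAt_iterate_sq (2 * m + 2) p).differentiableAt, ?_⟩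
    rw [hφ.deriv_iterate_sq]
    exact contDiff_const.mul (Complex.ofRealCLM.contDiff.mul ih)

lemma RapidDecay.iteratedDeriv_iterate_sq {φ : ℝ → ℂ} (hφ : RapidDecay φ)
    (h2 : ContDiff ℝ ∞ fun p : ℝ => lineLift^[2] φ (p ^ 2)) (m : ℕ) :
    iteratedDeriv (2 * m) (fun p : ℝ => lineLift^[2 * m + 2] φ (p ^ 2)) 0
      = evenConst m * lineLift^[2] φ 0 := by
  induction m with
  | zero => simp [evenConst]
  | succ m ih =>
    rw [show 2 * (m + 1) = 2 * m + 1 + 1 by ring, iteratedDeriv_succ',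
      show 2 * m + 1 + 1 + 2 = 2 * m + 2 + 2 by ring, hφ.deriv_iterate_sq,
      iteratedDeriv_const_mul_field, iteratedDeriv_succ_ofReal_mul (hφ.contDiff_iterate_sq h2 m)]
    simp only [Complex.ofReal_zero, zero_mul, zero_add, ih]
    rw [evenConst, evenConst, Finset.prod_range_succ]
    push_cast
    ring

lemma RapidDecay.contDiff_iterate {φ : ℝ → ℂ} (hφ : RapidDecay φ) (m : ℕ) :
    ContDiff ℝ m (lineLift^[2 * m] φ) := by
  induction m with
  | zero => simpa using hφ.continuous
  | succ m ih =>
    push_cast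
    rw [show 2 * (m + 1) = 2 * m + 2 by ring]
    refine contDiff_succ_iff_deriv.2 ⟨fun σ => (hφ.hasDerivAt_iterate _ σ).differentiableAt,
      by simp, ?_⟩
    rw [hφ.deriv_iterate]
    exact contDiff_const.mul ih

lemma RapidDecay.iteratedDeriv_iterate {φ : ℝ → ℂ} (hφ : RapidDecay φ) (m : ℕ) :
    iteratedDeriv m (lineLift^[2 * m] φ) = fun σ => (-Real.pi : ℂ) ^ m * φ σ := by
  induction m with
  | zero => simp
  | succ m ih =>
    ext σ
    rw [iteratedDeriv_succ', show 2 * (m + 1) = 2 * m + 2 by ring, hφ.deriv_iterate,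
      iteratedDeriv_const_mul_field, ih]
    ring

/-! ### The Abel integral -/

lemma image_sqrt_sq_sub {r : ℝ} (hr : 0 ≤ r) :
    (fun p => Real.sqrt (p ^ 2 - r ^ 2)) '' Ioi r = Ioi 0 := by
  ext u
  simp only [mem_image, mem_Ioi]
  constructor
  · rintro ⟨p, hp, rfl⟩
    exact Real.sqrt_pos.2 (by nlinarith)
  · intro hu
    refine ⟨Real.sqrt (r ^ 2 + u ^ 2), Real.lt_sqrt_of_sq_lt (by nlinarith), ?_⟩
    rw [Real.sq_sqrt (by positivity), add_sub_cancel_left, Real.sqrt_sq hu.le]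

/-- The substitution `u = √(p² - r²)`, whose derivative `p / √(p² - r²)` is the Abel kernel. -/
lemma abel_substitution {ψ : ℝ → ℂ} {r : ℝ} (hr : 0 ≤ r)
    (hψ : IntegrableOn (fun u => ψ (r ^ 2 + u ^ 2)) (Ioi 0)) :
    IntegrableOn (fun p : ℝ => ((p ^ 2 - r ^ 2) ^ (-(1 / 2) : ℝ) : ℝ) • ((p : ℂ) * ψ (p ^ 2)))
      (Ioi r) ∧
    ∫ p in Ioi r, ((p ^ 2 - r ^ 2) ^ (-(1 / 2) : ℝ) : ℝ) • ((p : ℂ) * ψ (p ^ 2))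
      = ∫ u in Ioi (0 : ℝ), ψ (r ^ 2 + u ^ 2) := by
  have hpos : ∀ p ∈ Ioi r, 0 < p ^ 2 - r ^ 2 := fun p hp => by
    have : r < p := hp
    nlinarith
  have hderiv : ∀ p ∈ Ioi r, HasDerivWithinAt (fun p => Real.sqrt (p ^ 2 - r ^ 2))
      (p / Real.sqrt (p ^ 2 - r ^ 2)) (Ioi r) p := fun p hp => by
    have := (((hasDerivAt_pow 2 p).sub_const (r ^ 2)).sqrt (hpos p hp).ne').hasDerivWithinAt
      (s := Ioi r)
    convert! this using 1
    simp
    field_simp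
  have hinj : InjOn (fun p => Real.sqrt (p ^ 2 - r ^ 2)) (Ioi r) := fun p hp q hq h => by
    have h1 := (Real.sqrt_inj (hpos p hp).le (hpos q hq).le).1 h
    exact (pow_left_inj₀ (hr.trans (le_of_lt hp)) (hr.trans (le_of_lt hq)) two_ne_zero).1
      (by linarith)
  have hcongr : ∀ p ∈ Ioi r, |p / Real.sqrt (p ^ 2 - r ^ 2)| •
      ψ (r ^ 2 + Real.sqrt (p ^ 2 - r ^ 2) ^ 2)
        = ((p ^ 2 - r ^ 2) ^ (-(1 / 2) : ℝ) : ℝ) • ((p : ℂ) * ψ (p ^ 2)) := fun p hp => by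
    have hp0 : 0 ≤ p := hr.trans (le_of_lt hp)
    rw [Real.sq_sqrt (hpos p hp).le, add_sub_cancel, abs_of_nonneg (by positivity),
      Real.rpow_neg (hpos p hp).le, ← Real.sqrt_eq_rpow, Complex.real_smul, Complex.real_smul]
    push_cast
    ring
  constructor
  · rw [← image_sqrt_sq_sub hr, integrableOn_image_iff_integrableOn_abs_deriv_smul
      measurableSet_Ioi hderiv hinj] at hψ
    exact hψ.congr_fun hcongr measurableSet_Ioi
  · rw [← image_sqrt_sq_sub hr, integral_image_eq_integral_abs_deriv_smul
      measurableSet_Ioi hderiv hinj]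
    exact (setIntegral_congr_fun measurableSet_Ioi hcongr).symm

lemma RapidDecay.lineLift_eq_two_mul {ψ : ℝ → ℂ} (hψ : RapidDecay ψ) (σ : ℝ) :
    lineLift ψ σ = 2 * ∫ u in Ioi (0 : ℝ), ψ (σ + u ^ 2) := by
  have h := hψ.integrable_comp_add_sq σ
  have hneg : ∫ u in Iic (0 : ℝ), ψ (σ + u ^ 2) = ∫ u in Ioi (0 : ℝ), ψ (σ + u ^ 2) := by
    have := integral_comp_neg_Iic 0 fun u => ψ (σ + u ^ 2)
    simpa using this
  rw [lineLift, ← intervalIntegral.integral_Iic_add_Ioi h.integrableOn h.integrableOn, hneg,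
    two_mul]

/-! ### Spherical means -/

section SphericalMean

variable {n : ℕ}

instance : (haarO n).IsHaarMeasure := by unfold haarO; infer_instance

instance : IsProbabilityMeasure (haarO n) :=
  ⟨by simpa [haarO] using Measure.haarMeasure_self (G := O n) (K₀ := ⊤)⟩

/-- A right translate of the normalized Haar measure is again a Haar probability measure, hence
equal to it. -/
instance : (haarO n).IsMulRightInvariant where
  map_mul_right_eq_self g := by
    have : IsProbabilityMeasure ((haarO n).map (· * g)) :=
      Measure.isProbabilityMeasure_map (by fun_prop)
    exact Measure.isHaarMeasure_eq_of_isProbabilityMeasure _ _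

lemma continuous_orthogonal_apply : Continuous fun q : O n × E n => (q.1 : E n →L[ℝ] E n) q.2 := by
  fun_prop

/-- The mean of `f` over the sphere with centre `x` through `x + v`, as an average over `O(n)`. -/
noncomputable def sphericalMean (f : E n → ℂ) (x v : E n) : ℂ :=
  ∫ k : O n, f (x + (k : E n →L[ℝ] E n) v) ∂(haarO n)

lemma exists_orthogonal_apply_eq {v w : E n} (h : ‖v‖ = ‖w‖) :
    ∃ k : O n, (k : E n →L[ℝ] E n) v = w :=
  ⟨Unitary.linearIsometryEquiv.symm (ℝ ∙ (v - w))ᗮ.reflection, Submodule.reflection_sub h⟩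

lemma sphericalMean_eq_of_norm_eq (f : E n → ℂ) (x : E n) {v w : E n} (h : ‖v‖ = ‖w‖) :
    sphericalMean f x v = sphericalMean f x w := by
  obtain ⟨k₀, rfl⟩ := exists_orthogonal_apply_eq h
  exact (integral_mul_right_eq_self
    (fun k : O n => f (x + (k : E n →L[ℝ] E n) v)) k₀).symm

lemma sphericalMean_zero (f : E n → ℂ) (x : E n) : sphericalMean f x 0 = f x := by
  simp [sphericalMean]

end SphericalMean

section RadialDerivatives

variable {n : ℕ}

lemma schwartz_decay_translate (f : 𝓢(E n, ℂ)) (x : E n) (N j : ℕ) :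
    ∃ C : ℝ, ∀ w, (1 + ‖w‖) ^ N * ‖iteratedFDeriv ℝ j f (x + w)‖ ≤ C := by
  refine ⟨(1 + ‖x‖) ^ N *
    (2 ^ N * (Finset.Iic (N, j)).sup (fun m => SchwartzMap.seminorm ℝ m.1 m.2) f), fun w => ?_⟩
  have h := SchwartzMap.one_add_le_sup_seminorm_apply (𝕜 := ℝ) (m := (N, j)) le_rfl le_rfl f (x + w)
  have h1 : 1 + ‖w‖ ≤ (1 + ‖x‖) * (1 + ‖x + w‖) := by
    have : ‖w‖ ≤ ‖x + w‖ + ‖x‖ := by simpa using norm_sub_le (x + w) x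
    nlinarith [norm_nonneg x, norm_nonneg (x + w)]
  calc (1 + ‖w‖) ^ N * ‖iteratedFDeriv ℝ j f (x + w)‖
      ≤ ((1 + ‖x‖) * (1 + ‖x + w‖)) ^ N * ‖iteratedFDeriv ℝ j f (x + w)‖ := by gcongr
    _ = (1 + ‖x‖) ^ N * ((1 + ‖x + w‖) ^ N * ‖iteratedFDeriv ℝ j f (x + w)‖) := by
        rw [mul_pow, mul_assoc]
    _ ≤ _ := by gcongr

/-- The `j`-th derivative of `s ↦ sphericalMean f x (s • e)`, written as the average of the `j`-th
derivative of `f` along the rotated direction. -/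
noncomputable def radialDeriv (f : E n → ℂ) (x e : E n) (j : ℕ) (s : ℝ) : ℂ :=
  ∫ k : O n, iteratedFDeriv ℝ j f (x + s • (k : E n →L[ℝ] E n) e)
    (fun _ => (k : E n →L[ℝ] E n) e) ∂(haarO n)

lemma norm_orthogonal_apply (k : O n) (v : E n) : ‖(k : E n →L[ℝ] E n) v‖ = ‖v‖ :=
  Unitary.norm_map k v

lemma continuous_radial_integrand (f : 𝓢(E n, ℂ)) (x e : E n) (j : ℕ) (s : ℝ) :
    Continuous fun k : O n => iteratedFDeriv ℝ j f (x + s • (k : E n →L[ℝ] E n) e)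
      (fun _ => (k : E n →L[ℝ] E n) e) := by
  have h1 : Continuous (iteratedFDeriv ℝ j f) :=
    (f.smooth ⊤).continuous_iteratedFDeriv (by exact_mod_cast le_top)
  have h2 : Continuous fun k : O n => (k : E n →L[ℝ] E n) e := by fun_prop
  have h3 : Continuous fun k : O n => iteratedFDeriv ℝ j f (x + s • (k : E n →L[ℝ] E n) e) :=
    h1.comp (by fun_prop)
  exact h3.eval (continuous_pi fun _ => h2)

lemma norm_radial_integrand_le (f : 𝓢(E n, ℂ)) (x : E n) {e : E n} (he : ‖e‖ = 1) (N j : ℕ) :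
    ∃ C : ℝ, ∀ (s : ℝ) (k : O n), (1 + |s|) ^ N *
      ‖iteratedFDeriv ℝ j f (x + s • (k : E n →L[ℝ] E n) e)
        (fun _ => (k : E n →L[ℝ] E n) e)‖ ≤ C := by
  obtain ⟨C, hC⟩ := schwartz_decay_translate f x N j
  refine ⟨C, fun s k => le_trans ?_ (hC (s • (k : E n →L[ℝ] E n) e))⟩
  rw [norm_smul, norm_orthogonal_apply, he, mul_one, Real.norm_eq_abs]
  gcongr
  refine (ContinuousMultilinearMap.le_opNorm _ _).trans ?_
  simp [norm_orthogonal_apply, he]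

lemma hasDerivAt_radial_integrand (f : 𝓢(E n, ℂ)) (x v : E n) (j : ℕ) (s : ℝ) :
    HasDerivAt (fun t : ℝ => iteratedFDeriv ℝ j f (x + t • v) (fun _ => v))
      (iteratedFDeriv ℝ (j + 1) f (x + s • v) (fun _ => v)) s := by
  have h1 : HasFDerivAt (iteratedFDeriv ℝ j f) (fderiv ℝ (iteratedFDeriv ℝ j f) (x + s • v))
      (x + s • v) :=
    ((f.smooth ⊤).differentiable_iteratedFDeriv (by exact_mod_cast WithTop.coe_lt_top j)
      _).hasFDerivAt
  have h2 : HasDerivAt (fun t : ℝ => x + t • v) v s := by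
    simpa using ((hasDerivAt_id s).smul_const v).const_add x
  have h3 := h1.comp_hasDerivAt s h2
  exact (ContinuousMultilinearMap.apply ℝ (fun _ : Fin j => E n) ℂ
    (fun _ => v)).hasFDerivAt.comp_hasDerivAt s h3

lemma hasDerivAt_radialDeriv (f : 𝓢(E n, ℂ)) (x : E n) {e : E n} (he : ‖e‖ = 1) (j : ℕ) (s : ℝ) :
    HasDerivAt (radialDeriv f x e j) (radialDeriv f x e (j + 1) s) s := by
  obtain ⟨C, hC⟩ := norm_radial_integrand_le f x he 0 (j + 1)
  refine (hasDerivAt_integral_of_dominated_loc_of_deriv_le (s := univ) (bound := fun _ => C)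
    univ_mem (Eventually.of_forall fun t =>
      (continuous_radial_integrand f x e j t).aestronglyMeasurable)
    ((continuous_radial_integrand f x e j s).integrable_of_hasCompactSupport
      (HasCompactSupport.of_compactSpace _))
    (continuous_radial_integrand f x e (j + 1) s).aestronglyMeasurable
    (Eventually.of_forall fun k t _ => by simpa using hC t k) (integrable_const _)
    (Eventually.of_forall fun k t _ => hasDerivAt_radial_integrand f x _ j t)).2

lemma contDiff_radialDeriv (f : 𝓢(E n, ℂ)) (x : E n) {e : E n} (he : ‖e‖ = 1) (j : ℕ) :
    ContDiff ℝ ∞ (radialDeriv f x e j) := by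
  refine contDiff_infty.2 fun m => ?_
  induction m generalizing j with
  | zero => exact contDiff_zero.2 (continuous_iff_continuousAt.2 fun s =>
      (hasDerivAt_radialDeriv f x he j s).continuousAt)
  | succ m ih =>
    push_cast
    refine contDiff_succ_iff_deriv.2 ⟨fun s => (hasDerivAt_radialDeriv f x he j s).differentiableAt,
      by simp, ?_⟩
    rw [funext fun s => (hasDerivAt_radialDeriv f x he j s).deriv]
    exact ih (j + 1)

lemma radialDeriv_decay (f : 𝓢(E n, ℂ)) (x : E n) {e : E n} (he : ‖e‖ = 1) (N j : ℕ) :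
    ∃ C : ℝ, ∀ s : ℝ, (1 + |s|) ^ N * ‖radialDeriv f x e j s‖ ≤ C := by
  obtain ⟨C, hC⟩ := norm_radial_integrand_le f x he N j
  refine ⟨C, fun s => ?_⟩
  have h0 : 0 < (1 + |s|) ^ N := by positivity
  rw [mul_comm, ← le_div_iff₀ h0]
  have := norm_integral_le_of_norm_le_const (μ := haarO n) (C := C / (1 + |s|) ^ N)
    (Eventually.of_forall fun k => (le_div_iff₀ h0).2 (by rw [mul_comm]; exact hC s k))
  simpa [radialDeriv] using this

lemma radialDeriv_zero (f : E n → ℂ) (x e : E n) (s : ℝ) :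
    radialDeriv f x e 0 s = sphericalMean f x (s • e) := by
  simp [radialDeriv, sphericalMean]

end RadialDerivatives

/-! ### Integration over planes -/

section Planes

variable {d n : ℕ}

lemma planeMeasure_eq_map (ξ : DPlane d n) {g : E d → E n} (hg : Isometry g)
    (hr : range g = (ξ.1 : Set (E n))) : planeMeasure ξ = (volume : Measure (E d)).map g := by
  rw [planeMeasure, ← hr, ← hg.map_euclideanHausdorffMeasure,
    EuclideanSpace.euclideanHausdorffMeasure_eq_volume]

/-- Every `d`-plane is an isometric copy of `ℝᵈ`. -/
lemma DPlane.exists_isometry (ξ : DPlane d n) :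
    ∃ (c : E n) (L : E d →ₗᵢ[ℝ] E n), range (fun y => c + L y) = (ξ.1 : Set (E n)) := by
  obtain ⟨c, hc⟩ := ξ.2.1
  let b := (stdOrthonormalBasis ℝ ξ.1.direction).reindex (finCongr ξ.2.2)
  refine ⟨c, ξ.1.direction.subtypeₗᵢ.comp b.repr.symm.toLinearIsometry, ?_⟩
  ext z
  simp only [mem_range, SetLike.mem_coe]
  constructor
  · rintro ⟨y, rfl⟩
    rw [add_comm]
    exact AffineSubspace.vadd_mem_of_mem_direction (b.repr.symm y).2 hc
  · intro hz
    refine ⟨b.repr ⟨z - c, AffineSubspace.vsub_mem_direction hz hc⟩, ?_⟩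
    simp

lemma isometry_const_add (c : E n) (L : E d →ₗᵢ[ℝ] E n) : Isometry fun y => c + L y :=
  (IsometryEquiv.addLeft c).isometry.comp L.isometry

lemma integrable_planeMeasure (f : 𝓢(E n, ℂ)) (ξ : DPlane d n) :
    Integrable f (planeMeasure ξ) := by
  obtain ⟨c, L, hr⟩ := ξ.exists_isometry
  have hg := isometry_const_add c L
  rw [planeMeasure_eq_map ξ hg hr, hg.isClosedEmbedding.measurableEmbedding.integrable_map_iff]
  have hL : (fun y : E d => c + L y).HasTemperateGrowth :=
    (Function.HasTemperateGrowth.const c).add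
      L.toContinuousLinearMap.hasTemperateGrowth
  exact (SchwartzMap.compCLMOfAntilipschitz ℝ hL hg.antilipschitz f).integrable

lemma dPlaneTransform_eq (f : E n → ℂ) (ξ : DPlane d n) {g : E d → E n} (hg : Isometry g)
    (hr : range g = (ξ.1 : Set (E n))) : dPlaneTransform d f ξ = ∫ y, f (g y) := by
  rw [dPlaneTransform, planeMeasure_eq_map ξ hg hr,
    hg.isClosedEmbedding.measurableEmbedding.integral_map]

lemma orthonormal_castLE (h : d < n) : Orthonormal ℝ (fun i : Fin d =>
    (EuclideanSpace.single (Fin.castLE h.le i) (1 : ℝ) : E n)) :=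
  EuclideanSpace.orthonormal_single.comp _ (Fin.castLE_injective h.le)

/-- The isometric inclusion of `ℝᵈ` into `ℝⁿ` as the span of the first `d` coordinate vectors. -/
noncomputable def coordInclusion (h : d < n) : E d →ₗᵢ[ℝ] E n :=
  LinearMap.isometryOfOrthonormal
    ((EuclideanSpace.basisFun (Fin d) ℝ).toBasis.constr ℝ
      fun i : Fin d => (EuclideanSpace.single (Fin.castLE h.le i) (1 : ℝ) : E n))
    (v := (EuclideanSpace.basisFun (Fin d) ℝ).toBasis)
    (by simp) (by
      have hcomp : _ ∘ (EuclideanSpace.basisFun (Fin d) ℝ).toBasis = _ :=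
        funext ((EuclideanSpace.basisFun (Fin d) ℝ).toBasis.constr_basis ℝ
          fun i : Fin d => (EuclideanSpace.single (Fin.castLE h.le i) (1 : ℝ) : E n))
      rw [hcomp]
      exact orthonormal_castLE h)

lemma range_coordInclusion (h : d < n) : LinearMap.range (coordInclusion h).toLinearMap =
    Submodule.span ℝ (range fun i : Fin d =>
      (EuclideanSpace.single (Fin.castLE h.le i) (1 : ℝ) : E n)) :=
  Module.Basis.constr_range (EuclideanSpace.basisFun (Fin d) ℝ).toBasis ℝ

lemma norm_sq_add_coordInclusion (h : d < n) (p : ℝ) (y : E d) :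
    ‖p • (EuclideanSpace.single (⟨d, h⟩ : Fin n) (1 : ℝ) : E n) + coordInclusion h y‖ ^ 2
      = p ^ 2 + ‖y‖ ^ 2 := by
  have hmem : coordInclusion h y ∈ Submodule.span ℝ (range fun i : Fin d =>
      (EuclideanSpace.single (Fin.castLE h.le i) (1 : ℝ) : E n)) := by
    rw [← range_coordInclusion h]
    exact ⟨y, rfl⟩
  have hle : Submodule.span ℝ (range fun i : Fin d =>
      (EuclideanSpace.single (Fin.castLE h.le i) (1 : ℝ) : E n)) ≤
      (ℝ ∙ (EuclideanSpace.single (⟨d, h⟩ : Fin n) (1 : ℝ) : E n))ᗮ := by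
    rw [Submodule.span_le]
    rintro _ ⟨i, rfl⟩
    rw [SetLike.mem_coe, Submodule.mem_orthogonal_singleton_iff_inner_right]
    have : (⟨d, h⟩ : Fin n) ≠ Fin.castLE h.le i := by
      intro hh
      have := congrArg Fin.val hh
      simp at this
      omega
    exact EuclideanSpace.orthonormal_single.2 this
  have hin := Submodule.mem_orthogonal_singleton_iff_inner_right.1 (hle hmem)
  rw [norm_add_sq_real, inner_smul_left, hin, norm_smul, LinearIsometry.norm_map]
  simp

lemma range_rotate_basePlane (h : d < n) (x : E n) (p : ℝ) (k : O n) :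
    range (fun y : E d => x + (k : E n →L[ℝ] E n)
      (p • EuclideanSpace.single (⟨d, h⟩ : Fin n) (1 : ℝ) + coordInclusion h y))
      = ((rotate x k (basePlane h x p)).1 : Set (E n)) := by
  ext z
  simp only [rotate, basePlane, AffineSubspace.coe_map, mem_range, mem_image, SetLike.mem_coe,
    AffineSubspace.mem_mk', ← range_coordInclusion h, LinearMap.mem_range]
  constructor
  · rintro ⟨y, rfl⟩
    refine ⟨x + p • EuclideanSpace.single (⟨d, h⟩ : Fin n) (1 : ℝ) + coordInclusion h y,
      ⟨y, by simp⟩, ?_⟩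
    simp [motion, add_assoc, add_comm]
    rfl
  · rintro ⟨w, ⟨y, hy⟩, rfl⟩
    refine ⟨y, ?_⟩
    have : w = x + p • EuclideanSpace.single (⟨d, h⟩ : Fin n) (1 : ℝ) + coordInclusion h y := by
      have hy' : coordInclusion h y
          = w - (x + p • EuclideanSpace.single (⟨d, h⟩ : Fin n) (1 : ℝ)) := hy
      rw [hy']; abel
    rw [this]
    simp [motion, add_assoc, add_comm]
    rfl

lemma isometry_rotate_basePlane (h : d < n) (x : E n) (p : ℝ) (k : O n) :
    Isometry (fun y : E d => x + (k : E n →L[ℝ] E n)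
      (p • EuclideanSpace.single (⟨d, h⟩ : Fin n) (1 : ℝ) + coordInclusion h y)) :=
  (IsometryEquiv.addLeft x).isometry.comp <| (Unitary.linearIsometryEquiv k).isometry.comp <|
    isometry_const_add _ _

lemma integrable_prod_plane (h : d < n) (f : 𝓢(E n, ℂ)) (x : E n) (p : ℝ) :
    Integrable (fun q : O n × E d => f (x + (q.1 : E n →L[ℝ] E n)
      (p • EuclideanSpace.single (⟨d, h⟩ : Fin n) (1 : ℝ) + coordInclusion h q.2)))
      ((haarO n).prod volume) := by
  obtain ⟨C, hC⟩ := schwartz_decay_translate f x (d + 1) 0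
  have hint : Integrable (fun y : E d => (1 + ‖y‖) ^ (-(d + 1 : ℝ))) :=
    integrable_one_add_norm (by simp)
  refine (((integrable_const (1 : ℝ)).mul_prod hint).const_mul C).mono' ?_
    (Eventually.of_forall fun q => ?_)
  · exact (f.continuous.comp (continuous_const.add (continuous_orthogonal_apply.comp
      (continuous_fst.prodMk (continuous_const.add
        ((coordInclusion h).continuous.comp continuous_snd)))))).aestronglyMeasurable
  · set v := p • (EuclideanSpace.single (⟨d, h⟩ : Fin n) (1 : ℝ) : E n) + coordInclusion h q.2
      with hv
    have h1 : ‖q.2‖ ≤ ‖v‖ := by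
      refine le_of_sq_le_sq ?_ (norm_nonneg _)
      rw [hv, norm_sq_add_coordInclusion]
      nlinarith [sq_nonneg p]
    have h2 := hC ((q.1 : E n →L[ℝ] E n) v)
    rw [norm_orthogonal_apply, norm_iteratedFDeriv_zero] at h2
    rw [Real.rpow_neg (by positivity), one_mul, ← div_eq_mul_inv, le_div_iff₀ (by positivity),
      mul_comm]
    refine le_trans ?_ h2
    rw [show (d + 1 : ℝ) = ((d + 1 : ℕ) : ℝ) by push_cast; rfl, Real.rpow_natCast]
    gcongr

lemma integrable_rotate (h : d < n) (f : 𝓢(E n, ℂ)) (x : E n) (p : ℝ) :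
    Integrable (fun k : O n => dPlaneTransform d f (rotate x k (basePlane h x p))) (haarO n) := by
  simp_rw [fun k => dPlaneTransform_eq f _ (isometry_rotate_basePlane h x p k)
    (range_rotate_basePlane h x p k)]
  exact (integrable_prod_plane h f x p).integral_prod_left

lemma hatCheck_eq_integral_sphericalMean (h : d < n) (f : 𝓢(E n, ℂ)) (x : E n) (p : ℝ) :
    hatCheck h f x p = ∫ y : E d, sphericalMean f x
      (p • EuclideanSpace.single (⟨d, h⟩ : Fin n) (1 : ℝ) + coordInclusion h y) := by
  simp_rw [hatCheck, dualAverage, fun k => dPlaneTransform_eq f _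
    (isometry_rotate_basePlane h x p k) (range_rotate_basePlane h x p k)]
  exact integral_integral_swap (integrable_prod_plane h f x p)

end Planes

/-! ### The dual average as an iterated lift -/

section RadialProfile

variable {n : ℕ}

lemma radialDeriv_zero_neg (f : E n → ℂ) (x e : E n) (s : ℝ) :
    radialDeriv f x e 0 (-s) = radialDeriv f x e 0 s := by
  rw [radialDeriv_zero, radialDeriv_zero]
  exact sphericalMean_eq_of_norm_eq f x (by simp [norm_smul])

lemma radialDeriv_zero_abs (f : E n → ℂ) (x e : E n) (s : ℝ) :
    radialDeriv f x e 0 |s| = radialDeriv f x e 0 s := by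
  rcases abs_choice s with h | h
  · rw [h]
  · rw [h, radialDeriv_zero_neg]

lemma radialDeriv_one_apply_zero (f : 𝓢(E n, ℂ)) (x : E n) {e : E n} (he : ‖e‖ = 1) :
    radialDeriv f x e 1 0 = 0 := by
  have h1 := hasDerivAt_radialDeriv f x he 0 0
  have h2 : HasDerivAt (radialDeriv f x e 0) (-radialDeriv f x e 1 0) 0 := by
    have h3 := hasDerivAt_radialDeriv f x he 0 (-0)
    have := h3.scomp (0 : ℝ) (hasDerivAt_neg (0 : ℝ))
    rw [show radialDeriv f x e 0 ∘ Neg.neg = radialDeriv f x e 0 from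
      funext fun s => radialDeriv_zero_neg f x e s] at this
    simpa using this
  have h := h1.unique h2
  exact self_eq_neg.1 h

/-- The function whose second lift is the spherical mean as a function of the squared radius:
`-(1/π)` times the derivative of `σ ↦ F(√σ)`, where `F` is the spherical mean on the ray of `e`.
That derivative is `F'(s) / (2s)` at `s = √σ`; `dslope` gives it the limit value `F''(0) / 2` at
`s = 0`, and `√σ = 0` for `σ < 0` extends it by this constant to the negative half-line. -/
noncomputable def radialProfile (f : E n → ℂ) (x e : E n) (σ : ℝ) : ℂ :=
  (-(1 / (2 * Real.pi)) : ℂ) * dslope (radialDeriv f x e 1) 0 (Real.sqrt σ)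

lemma radialProfile_of_pos (f : 𝓢(E n, ℂ)) (x : E n) {e : E n} (he : ‖e‖ = 1) {σ : ℝ}
    (hσ : 0 < σ) : radialProfile f x e σ
      = (-(1 / (2 * Real.pi)) : ℂ) * ((Real.sqrt σ)⁻¹ * radialDeriv f x e 1 (Real.sqrt σ)) := by
  rw [radialProfile, dslope_of_ne _ (Real.sqrt_pos.2 hσ).ne', slope_def_module,
    radialDeriv_one_apply_zero f x he]
  simp

lemma rapidDecay_radialProfile (f : 𝓢(E n, ℂ)) (x : E n) {e : E n} (he : ‖e‖ = 1) :
    RapidDecay (radialProfile f x e) := by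
  have hd : Differentiable ℝ (radialDeriv f x e 1) := fun s =>
    (hasDerivAt_radialDeriv f x he 1 s).differentiableAt
  have hc : Continuous (dslope (radialDeriv f x e 1) 0) := by
    refine continuous_iff_continuousAt.2 fun s => ?_
    rcases eq_or_ne s 0 with rfl | hs
    · exact continuousAt_dslope_same.2 (hd 0)
    · exact (continuousAt_dslope_of_ne hs).2 (hd s).continuousAt
  refine RapidDecay.of_bound (continuous_const.mul (hc.comp Real.continuous_sqrt)) fun N => ?_
  obtain ⟨C, hC⟩ := radialDeriv_decay f x he (2 * N) 1
  refine ⟨C, fun σ hσ => le_trans ?_ (hC (Real.sqrt σ))⟩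
  have h1 : 1 ≤ Real.sqrt σ := Real.one_le_sqrt.2 hσ
  have h2 : σ ^ N ≤ (1 + |Real.sqrt σ|) ^ (2 * N) := by
    rw [pow_mul]
    gcongr
    rw [abs_of_nonneg (by positivity)]
    nlinarith [Real.sq_sqrt (zero_le_one.trans hσ)]
  have h3 : ‖radialProfile f x e σ‖ ≤ ‖radialDeriv f x e 1 (Real.sqrt σ)‖ := by
    rw [radialProfile_of_pos f x he (by linarith), norm_mul, norm_mul]
    have h4 : ‖(-(1 / (2 * Real.pi)) : ℂ)‖ ≤ 1 := by
      rw [norm_neg, norm_div, norm_mul, Complex.norm_real, Real.norm_of_nonneg Real.pi_pos.le]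
      rw [norm_one, Complex.norm_ofNat, div_le_one (by positivity)]
      linarith [Real.pi_gt_three]
    have h5 : ‖(((Real.sqrt σ)⁻¹ : ℝ) : ℂ)‖ ≤ 1 := by
      rw [Complex.norm_real, Real.norm_of_nonneg (by positivity)]
      exact inv_le_one_of_one_le₀ h1
    calc _ ≤ 1 * (1 * ‖radialDeriv f x e 1 (Real.sqrt σ)‖) := by gcongr
      _ = _ := by ring
  gcongr

lemma iterate_radialProfile (f : 𝓢(E n, ℂ)) (x : E n) {e : E n} (he : ‖e‖ = 1) {σ : ℝ}
    (hσ : 0 ≤ σ) :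
    lineLift^[2] (radialProfile f x e) σ = radialDeriv f x e 0 (Real.sqrt σ) := by
  have hφ := rapidDecay_radialProfile f x he
  have hcont : Continuous (radialDeriv f x e 0) := (contDiff_radialDeriv f x he 0).continuous
  have hlim : Tendsto (radialDeriv f x e 0) atTop (𝓝 0) := by
    obtain ⟨C, hC⟩ := radialDeriv_decay f x he 1 0
    refine squeeze_zero_norm' (a := fun s : ℝ => C / s) ?_ (tendsto_const_nhds.div_atTop tendsto_id)
    filter_upwards [eventually_gt_atTop 0] with s hs
    rw [le_div_iff₀ hs, mul_comm]
    refine le_trans ?_ (hC s)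
    rw [pow_one, abs_of_pos hs]
    gcongr
    linarith
  have hderiv : ∀ t ∈ Ioi σ, HasDerivAt (fun t => radialDeriv f x e 0 (Real.sqrt t))
      ((-Real.pi : ℂ) * radialProfile f x e t) t := fun t ht => by
    have ht0 : 0 < t := hσ.trans_lt ht
    have := (hasDerivAt_radialDeriv f x he 0 (Real.sqrt t)).scomp t (Real.hasDerivAt_sqrt ht0.ne')
    convert! this using 1
    rw [radialProfile_of_pos f x he ht0]
    have : (Real.pi : ℂ) ≠ 0 := by exact_mod_cast Real.pi_ne_zero
    simp
    field_simp
  have := integral_Ioi_of_hasDerivAt_of_tendsto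
    (hcont.comp Real.continuous_sqrt).continuousWithinAt hderiv
    ((hφ.integrableOn_Ioi σ).const_mul _) (hlim.comp Real.tendsto_sqrt_atTop)
  rw [integral_const_mul] at this
  change lineLift (lineLift _) σ = _
  rw [hφ.lineLift_lineLift]
  simp only [Function.comp_apply] at this
  linear_combination -this

end RadialProfile

variable {d n : ℕ}

/-- The dual average of the `d`-plane transform as a `(d + 2)`-fold lift of a rapidly decaying
profile: two lifts give the spherical mean of `f`, the other `d` integrate over the plane. -/
theorem exists_radial_profile_hatCheck (h : d < n) (f : 𝓢(E n, ℂ)) (x : E n) :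
    ∃ φ : ℝ → ℂ, RapidDecay φ ∧ ContDiff ℝ ∞ (fun p : ℝ => lineLift^[2] φ (p ^ 2)) ∧
      lineLift^[2] φ 0 = f x ∧ hatCheck h f x = fun p => lineLift^[d + 2] φ (p ^ 2) := by
  set e : E n := EuclideanSpace.single (⟨d, h⟩ : Fin n) (1 : ℝ) with he_def
  have he : ‖e‖ = 1 := by simp [he_def]
  have hφ := rapidDecay_radialProfile f x he
  refine ⟨radialProfile f x e, hφ, ?_, ?_, funext fun p => ?_⟩
  · convert contDiff_radialDeriv f x he 0 using 2 with p
    rw [iterate_radialProfile f x he (sq_nonneg p), Real.sqrt_sq_eq_abs, radialDeriv_zero_abs]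
  · rw [iterate_radialProfile f x he le_rfl, radialDeriv_zero, Real.sqrt_zero, zero_smul,
      sphericalMean_zero]
  · have hmean : ∀ y : E d, sphericalMean f x (p • e + coordInclusion h y)
        = lineLift^[2] (radialProfile f x e) (p ^ 2 + ∑ i, y i ^ 2) := fun y => by
      have hsq : p ^ 2 + ∑ i, y i ^ 2 = ‖p • e + coordInclusion h y‖ ^ 2 := by
        rw [norm_sq_add_coordInclusion, EuclideanSpace.real_norm_sq_eq]
      rw [hsq, iterate_radialProfile f x he (sq_nonneg _), Real.sqrt_sq (norm_nonneg _),
        radialDeriv_zero]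
      exact sphericalMean_eq_of_norm_eq f x (by simp [norm_smul, he])
    rw [hatCheck_eq_integral_sphericalMean]
    simp_rw [← he_def, hmean]
    rw [Function.iterate_add_apply, ← (hφ.iterate 2).integral_comp_add_sum_sq]
    exact (EuclideanSpace.volume_preserving_symm_measurableEquiv_toLp (Fin d)).integral_comp
      (MeasurableEquiv.measurableEmbedding _)
      (fun y : Fin d → ℝ => lineLift^[2] (radialProfile f x e) (p ^ 2 + ∑ i, y i ^ 2))

/-- Differentiation lowers the number of lifts by two and the Abel integral raises it by one. -/
theorem abelIntegral_of_profile {h : d < n} {f : E n → ℂ} {x : E n} {φ : ℝ → ℂ}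
    (hφ : RapidDecay φ) (hH : hatCheck h f x = fun p => lineLift^[d + 2] φ (p ^ 2)) {r : ℝ}
    (hr : 0 ≤ r) :
    IntegrableOn (abelIntegrand h f x r) (Ioi r) ∧
      abelIntegral h f x r = (-Real.pi : ℂ) * lineLift^[d + 1] φ (r ^ 2) := by
  have hψ := hφ.iterate d
  obtain ⟨h1, h2⟩ := abel_substitution hr (hψ.integrable_comp_add_sq (r ^ 2)).integrableOn
  have heq : abelIntegrand h f x r = fun p => (-(2 * Real.pi) : ℂ) *
      (((p ^ 2 - r ^ 2) ^ (-(1 / 2) : ℝ) : ℝ) • ((p : ℂ) * lineLift^[d] φ (p ^ 2))) := by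
    ext p
    rw [abelIntegrand, hH, hφ.deriv_iterate_sq, mul_smul_comm]
  refine ⟨heq ▸ h1.const_mul _, ?_⟩
  rw [abelIntegral, heq, integral_const_mul, h2, Function.iterate_succ_apply',
    hψ.lineLift_eq_two_mul]
  ring

end DPlaneTransform

open DPlaneTransform in
theorem theorem4p1 (d : ℕ) (hd : 0 < d) :
    -- all integrals defining the transform and the averages converge absolutely
    (∀ (n : ℕ) (h : d < n) (f : 𝓢(E n, ℂ)),
      (∀ ξ : DPlane d n, Integrable f (planeMeasure ξ)) ∧
      (∀ (x : E n) (p : ℝ),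
        Integrable (fun k : O n => dPlaneTransform d f (rotate x k (basePlane h x p)))
          (haarO n))) ∧
    -- inversion for even d
    (Even d → ∃ C₁ : ℝ, ∀ (n : ℕ) (h : d < n) (f : 𝓢(E n, ℂ)) (x : E n),
      ContDiff ℝ d (hatCheck h f x) ∧
      f x = C₁ • iteratedDeriv d (hatCheck h f x) 0) ∧
    -- inversion for odd d
    (Odd d → ∃ C₂ : ℝ, ∀ (n : ℕ) (h : d < n) (f : 𝓢(E n, ℂ)) (x : E n),
      Differentiable ℝ (hatCheck h f x) ∧
      (∀ r : ℝ, 0 ≤ r → IntegrableOn (abelIntegrand h f x r) (Ioi r)) ∧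
      ContDiffOn ℝ ((d - 1) / 2 : ℕ) (fun s : ℝ => abelIntegral h f x (Real.sqrt s)) (Ici 0) ∧
      f x = C₂ • derivSqAtZero ((d - 1) / 2) (abelIntegral h f x)) ∧
    -- the case d = 1, with its explicit constant
    (d = 1 → ∀ (n : ℕ) (h : d < n) (f : 𝓢(E n, ℂ)) (x : E n),
      Differentiable ℝ (hatCheck h f x) ∧
      IntegrableOn (fun p : ℝ => (1 / p) • deriv (hatCheck h f x) p) (Ioi 0) ∧
      f x = -(1 / Real.pi) • ∫ p in Ioi (0 : ℝ), (1 / p) • deriv (hatCheck h f x) p) := by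
  have hπ : (Real.pi : ℂ) ≠ 0 := by exact_mod_cast Real.pi_ne_zero
  refine ⟨fun n h f => ⟨integrable_planeMeasure f, integrable_rotate h f⟩, ?_, ?_, ?_⟩
  · intro hd2
    obtain ⟨m, rfl⟩ := hd2.exists_two_nsmul
    rw [smul_eq_mul] at hd ⊢
    refine ⟨(evenConst m)⁻¹, fun n h f x => ?_⟩
    obtain ⟨φ, hφ, hsmooth, hval, hH⟩ := exists_radial_profile_hatCheck h f x
    rw [hH]
    refine ⟨contDiff_infty.1 (hφ.contDiff_iterate_sq hsmooth m) _, ?_⟩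
    rw [hφ.iteratedDeriv_iterate_sq hsmooth, hval, Complex.real_smul]
    have : (evenConst m : ℂ) ≠ 0 := by exact_mod_cast evenConst_ne_zero m
    push_cast
    field_simp
  · rintro ⟨m, rfl⟩
    rw [show (2 * m + 1 - 1) / 2 = m by omega]
    refine ⟨((-Real.pi) ^ (m + 1))⁻¹, fun n h f x => ?_⟩
    obtain ⟨φ, hφ, -, hval, hH⟩ := exists_radial_profile_hatCheck h f x
    -- The Abel integral carries `d + 1 = 2m + 2` lifts, so `m` derivatives leave the second lift,
    -- which at `0` is `f x`.
    have hA : EqOn (fun s : ℝ => abelIntegral h f x (Real.sqrt s))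
        (fun s => (-Real.pi : ℂ) * lineLift^[2 * m] (lineLift^[2] φ) s) (Ici 0) := fun s hs => by
      simp only [(abelIntegral_of_profile hφ hH (Real.sqrt_nonneg s)).2, Real.sq_sqrt hs,
        ← Function.iterate_add_apply]
    have hcd : ContDiff ℝ m
        (fun s => (-Real.pi : ℂ) * lineLift^[2 * m] (lineLift^[2] φ) s) :=
      contDiff_const.mul ((hφ.iterate 2).contDiff_iterate m)
    refine ⟨hH ▸ fun p => (hφ.hasDerivAt_iterate_sq _ p).differentiableAt,
      fun r hr => (abelIntegral_of_profile hφ hH hr).1, hcd.contDiffOn.congr hA, ?_⟩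
    rw [derivSqAtZero, iteratedDerivWithin_congr hA self_mem_Ici,
      iteratedDerivWithin_eq_iteratedDeriv (uniqueDiffOn_Ici 0) hcd.contDiffAt self_mem_Ici,
      iteratedDeriv_const_mul_field, (hφ.iterate 2).iteratedDeriv_iterate]
    simp only [hval, Complex.real_smul]
    push_cast
    field_simp
    ring
  · rintro rfl n h f x
    obtain ⟨φ, hφ, -, hval, hH⟩ := exists_radial_profile_hatCheck h f x
    obtain ⟨h1, h2⟩ := abelIntegral_of_profile hφ hH le_rfl
    have heq : EqOn (abelIntegrand h f x 0) (fun p : ℝ => (1 / p) • deriv (hatCheck h f x) p)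
        (Ioi 0) := fun p hp => by
      have hp0 : (0 : ℝ) ≤ p := le_of_lt hp
      rw [abelIntegrand, Real.rpow_neg (by nlinarith), ← Real.sqrt_eq_rpow]
      simp [Real.sqrt_sq hp0]
    refine ⟨hH ▸ fun p => (hφ.hasDerivAt_iterate_sq _ p).differentiableAt,
      h1.congr_fun heq measurableSet_Ioi, ?_⟩
    rw [← setIntegral_congr_fun measurableSet_Ioi heq]
    change f x = -(1 / Real.pi) • abelIntegral h f x 0
    rw [h2, ← hval, Complex.real_smul]
    push_cast
    field_simp
    simp
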